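/- Let $\mathbb L^4$ be $\mathbb R^4$ with the Lorentzian metric $\langle x,y\rangle=-x_0y_0+x_1y_1+x_2y_2+x_3y_3$ and let $\Lambda^+=\{v\in\mathbb L^4:\langle v,v\rangle=0,\ v_0>0\}$ be the future lightcone. Let $\psi:\mathbb S^2\to\mathbb L^4$ be a smooth spacelike immersion (that is, the induced metric $g=\psi^*\langle\,,\rangle$ is Riemannian) with $\psi(\mathbb S^2)\subset\Lambda^+$, and let $dA$ be the area measure of $g$. Let $u\in\mathbb L^4$ satisfy $\langle u,u\rangle=-1$ and $u_0<0$. Then the function $\langle\psi,u\rangle$ belongs to $L^2(\mathbb S^2,dA)$ and $$\mathrm{area}(\mathbb S^2,g)\le 2\sqrt{\pi}\,\|\langle\psi,u\rangle\|_{L^2(\mathbb S^2,dA)}.$$ Equality holds if and only if there is a real number $r>0$ such that $\langle\psi,u\rangle$ is constant equal to $r$ and the surface $\psi(\mathbb S^2)$ is the round sphere $$\mathbb S^2(u,r)=\{x\in\mathbb L^4:\langle x,x\rangle=0,\ \langle u,x\rangle=r\}.$$ Moreover, if $\psi(\mathbb S^2)=\mathbb S^2(u,r)$ for some $r>0$,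 then $\psi$ is totally umbilical, that is, at every point its second fundamental form satisfies $\mathrm{II}(X,Y)=\langle X,Y\rangle\,\mathbf H$ for some normal vector $\mathbf H$. -/

import Mathlib

open MeasureTheory Set
open scoped Manifold ContDiff

noncomputable section

namespace Lightcone

/-- The underlying vector space `ℝ⁴` of Lorentz-Minkowski spacetime, with coordinates
`x 0, x 1, x 2, x 3`. -/
abbrev L4 : Type := Fin 4 → ℝ

/-- The Lorentzian metric `-(dx₀)² + (dx₁)² + (dx₂)² + (dx₃)²`. -/
def mink (x y : L4) : ℝ := -(x 0 * y 0) + x 1 * y 1 + x 2 * y 2 + x 3 * y 3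

/-- The future lightcone `Λ⁺`. -/
def futureCone : Set L4 := {v | mink v v = 0 ∧ 0 < v 0}

/-- The round sphere `S²(u, r)` of the lightcone. -/
def roundSphere (u : L4) (r : ℝ) : Set L4 := {x | mink x x = 0 ∧ mink u x = r}

/-- The standard sphere `S²`, with Mathlib's smooth structure. -/
abbrev S2 : Type := Metric.sphere (0 : EuclideanSpace ℝ (Fin 3)) 1

section Surface

variable {M : Type*} [TopologicalSpace M] [ChartedSpace (EuclideanSpace ℝ (Fin 2)) M]

/-- The induced metric tensor `ψ^*⟨ , ⟩` at the point `p`. -/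
def inducedMetric (ψ : M → L4) (p : M) (v w : TangentSpace (𝓡 2) p) : ℝ :=
  mink (mfderiv (𝓡 2) 𝓘(ℝ, L4) ψ p v) (mfderiv (𝓡 2) 𝓘(ℝ, L4) ψ p w)

/-- A spacelike immersion of a surface: a smooth map whose induced metric tensor is positive
definite at every point. (Positive definiteness forces the differential to be injective.) -/
def IsSpacelikeImmersion (ψ : M → L4) : Prop :=
  ContMDiff (𝓡 2) 𝓘(ℝ, L4) ∞ ψ ∧
    ∀ (p : M) (v : TangentSpace (𝓡 2) p), v ≠ 0 → 0 < inducedMetric ψ p v v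

/-- The partial derivative `∂ᵢψ` in the coordinates given by the chart `e`. -/
def coordDeriv (ψ : M → L4) (e : OpenPartialHomeomorph M (EuclideanSpace ℝ (Fin 2))) (i : Fin 2)
    (y : EuclideanSpace ℝ (Fin 2)) : L4 :=
  fderiv ℝ (ψ ∘ e.symm) y (EuclideanSpace.single i 1)

/-- The area density `√(EG - F²)` of the induced metric in the coordinates given by `e`. -/
def areaDensity (ψ : M → L4) (e : OpenPartialHomeomorph M (EuclideanSpace ℝ (Fin 2)))
    (y : EuclideanSpace ℝ (Fin 2)) : ℝ :=
  Real.sqrt (mink (coordDeriv ψ e 0 y) (coordDeriv ψ e 0 y)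
      * mink (coordDeriv ψ e 1 y) (coordDeriv ψ e 1 y)
    - mink (coordDeriv ψ e 0 y) (coordDeriv ψ e 1 y) ^ 2)

/-- The area measure of the induced metric on the domain of the chart `e` (and zero outside):
`√(EG - F²) dx dy` on the image of `e`, transported to `M`. -/
def chartArea [MeasurableSpace M] (ψ : M → L4)
    (e : OpenPartialHomeomorph M (EuclideanSpace ℝ (Fin 2))) : Measure M :=
  ((volume.restrict e.target).withDensity fun y => ENNReal.ofReal (areaDensity ψ e y)).map e.symm

/-- The total umbilicity of `ψ`: `II(X, Y) = ⟨X, Y⟩ H` at every point `p`, for some normal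
vector `H`. As the connection of `ℝ⁴` is flat, `II(v, w)` is in coordinates the normal part of the
second derivative of `ψ` in the directions `v, w`. -/
def IsTotallyUmbilical (ψ : M → L4) : Prop :=
  ∀ p : M,
    let f : EuclideanSpace ℝ (Fin 2) → L4 := ψ ∘ (chartAt (EuclideanSpace ℝ (Fin 2)) p).symm
    let y : EuclideanSpace ℝ (Fin 2) := chartAt (EuclideanSpace ℝ (Fin 2)) p p
    ∃ H : L4, (∀ v, mink (fderiv ℝ f y v) H = 0) ∧
      ∀ v w, ∃ z, fderiv ℝ (fderiv ℝ f) y v w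
        = fderiv ℝ f y z + mink (fderiv ℝ f y v) (fderiv ℝ f y w) • H

variable (M)

theorem exists_chart_cover [SecondCountableTopology M] [Nonempty M] :
    ∃ c : ℕ → M, ⋃ k, (chartAt (EuclideanSpace ℝ (Fin 2)) (c k)).source = univ := by
  obtain ⟨s, hs, hcov⟩ := TopologicalSpace.countable_cover_nhds
    (fun x : M => (chartAt (EuclideanSpace ℝ (Fin 2)) x).open_source.mem_nhds
      (mem_chart_source (EuclideanSpace ℝ (Fin 2)) x))
  have hne : s.Nonempty := by
    rcases s.eq_empty_or_nonempty with h | h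
    · subst h
      simp only [biUnion_empty] at hcov
      exact absurd hcov.symm univ_nonempty.ne_empty
    · exact h
  obtain ⟨c, rfl⟩ := hs.exists_eq_range hne
  exact ⟨c, by simpa using hcov⟩

/-- The centres of a sequence of charts whose domains cover `M`. -/
def chartCenter [SecondCountableTopology M] [Nonempty M] (k : ℕ) : M :=
  (exists_chart_cover M).choose k

variable {M}

/-- The area measure `dA` of the induced metric: `M` is cut into countably many disjoint Borel
pieces, each in the domain of a chart, and on each piece `dA = √(EG - F²) dx dy` in that chart.
By the change of variables formula the choice of the charts and pieces does not matter. -/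
def areaMeasure [MeasurableSpace M] [SecondCountableTopology M] [Nonempty M] (ψ : M → L4) :
    Measure M :=
  Measure.sum fun k =>
    (chartArea ψ (chartAt (EuclideanSpace ℝ (Fin 2)) (chartCenter M k))).restrict
      (disjointed (fun j => (chartAt (EuclideanSpace ℝ (Fin 2)) (chartCenter M j)).source) k)

end Surface

instance nonempty_S2 : Nonempty S2 := (NormedSpace.sphere_nonempty.mpr zero_le_one).to_subtype

end Lightcone

end

open scoped ENNReal

namespace Lightcone

/-! Write `h = ⟨ψ, u⟩`. Since `u` is timelike and past-directed, `h > 0` on the lightcone. A Lorentz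
boost sending `-u` to the time axis turns `ψ` into `(h, h d)`, where `d`, the `direction` of `ψ`,
has values in the unit sphere of `ℝ³`. The radial part of the derivative is null, so the induced
metric is `h²` times the pullback of the round metric by `d` (`mink_fderiv_eq_direction`), and `dA`
is `h²` times the pulled back round area.

As `ψ` is spacelike, `d` is a local homeomorphism of the sphere to itself, hence a covering, hence a
bijection (`injective_of_isLocalHomeomorph`). Therefore `∫ h⁻² dA = 4π` (`lintegral_areaMeasure`).
The round area is handled as three times the volume of the cone over a piece of the sphere, which
reduces everything to the change of variables formula in `ℝ³` and the volume of the ball.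

Cauchy-Schwarz for `1 = h · h⁻¹` is now the inequality, with equality exactly when `h` is a constant
`r` (`measure_univ_le_mul_eLpNorm`). Surjectivity of `d` then makes the surface fill the round
sphere. For umbilicity, the equations `⟨f, f⟩ = 0` and `⟨f, u⟩ = r` are differentiated twice; they
determine the normal part of the second derivative (`exists_umbilical_vector`). -/

/-! ### Self-coverings of the sphere -/

theorem fact_finrank_three : Fact (Module.finrank ℝ (EuclideanSpace ℝ (Fin 3)) = 2 + 1) :=
  ⟨by simp⟩

theorem one_lt_rank_euclideanSpace_two : 1 < Module.rank ℝ (EuclideanSpace ℝ (Fin 2)) := by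
  rw [← Module.finrank_eq_rank, finrank_euclideanSpace_fin]
  norm_num

theorem preconnectedSpace_S2 : PreconnectedSpace S2 := by
  have h : 1 < Module.rank ℝ (EuclideanSpace ℝ (Fin 3)) := by
    rw [← Module.finrank_eq_rank, finrank_euclideanSpace_fin]
    norm_num
  exact isPreconnected_iff_preconnectedSpace.1 (isPreconnected_sphere h 0 1)

/-- From a compact space to a Hausdorff one, a local homeomorphism is a covering, so a fibre is both
discrete and compact. -/
theorem finite_fiber_of_isLocalHomeomorph {X Y : Type*} [TopologicalSpace X] [TopologicalSpace Y]
    [CompactSpace X] [T2Space X] [T2Space Y] {φ : X → Y} (hφ : IsLocalHomeomorph φ) (y : Y) :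
    (φ ⁻¹' {y}).Finite := by
  have hcov : IsCoveringMap φ := isLocalHomeomorph_iff_isCoveringMap.1 hφ
  have : DiscreteTopology (φ ⁻¹' {y}) := (hcov y).1
  exact (isClosed_singleton.preimage hφ.continuous).isCompact.finite ⟨this⟩

theorem surjective_of_isLocalHomeomorph {φ : S2 → S2} (hφ : IsLocalHomeomorph φ) :
    Function.Surjective φ := by
  have := preconnectedSpace_S2
  have hclopen : IsClopen (range φ) :=
    ⟨(isCompact_range hφ.continuous).isClosed, hφ.isOpenMap.isOpen_range⟩
  exact range_eq_univ.1 (hclopen.eq_univ (range_nonempty φ))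

/-- Stereographic projection from a point of `s` carries `sᶜ` to the complement of a finite set in
the plane. -/
theorem isPreconnected_compl_of_finite {s : Set S2} (hs : s.Finite) (hne : s.Nonempty) :
    IsPreconnected sᶜ := by
  have := fact_finrank_three
  obtain ⟨m, hm⟩ := hne
  set e := stereographic' 2 m with he
  have hsrc : e.source = {m}ᶜ := stereographic'_source m
  have htgt : e.target = univ := stereographic'_target m
  have hinj : Function.Injective e.symm := fun x y h => e.symm.injOn (by simp [htgt]) (by simp [htgt]) h
  have hcont : Continuous e.symm := by
    rw [← continuousOn_univ, ← htgt]
    exact e.continuousOn_symm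
  have himage : e.symm '' (e.symm ⁻¹' s)ᶜ = sᶜ := by
    rw [← preimage_compl, image_preimage_eq_inter_range, inter_eq_left]
    intro x hx
    have hx' : x ∈ e.source := by
      rw [hsrc]
      rintro rfl
      exact hx hm
    exact ⟨e x, e.left_inv hx'⟩
  rw [← himage]
  exact ((hs.preimage hinj.injOn).countable.isConnected_compl_of_one_lt_rank
    one_lt_rank_euclideanSpace_two).isPreconnected.image _ hcont.continuousOn

/-- The sphere `S²` has no nontrivial coverings by itself. -/
theorem injective_of_isLocalHomeomorph {φ : S2 → S2} (hφ : IsLocalHomeomorph φ) :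
    Function.Injective φ := by
  have := fact_finrank_three
  intro p p' hpp'
  -- Any point other than `φ p` would serve as the pole.
  set N : S2 := -φ p with hN
  have hφN : φ p ≠ N := ne_neg_of_mem_unit_sphere ℝ (φ p)
  set e := stereographic' 2 N with he
  have hsrc : e.source = {N}ᶜ := stereographic'_source N
  have htgt : e.target = univ := stereographic'_target N
  have hsymm : Topology.IsOpenEmbedding e.symm := e.symm.isOpenEmbedding (by simpa using htgt)
  have hcov : IsCoveringMap φ := isLocalHomeomorph_iff_isCoveringMap.1 hφ
  have hright : ∀ z, e (e.symm z) = z := fun z => e.right_inv (by simp [htgt])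
  have hleft : ∀ x, x ≠ N → e.symm (e x) = x := fun x hx => e.left_inv (by simpa [hsrc] using hx)
  -- The plane is simply connected, so the inverse stereographic chart lifts through the covering
  -- `φ`, starting at `p`.
  obtain ⟨σ, ⟨hσp, hσ⟩, -⟩ := hcov.existsUnique_continuousMap_lifts
    ⟨e.symm, hsymm.continuous⟩ (e (φ p)) p (by simpa using (hleft _ hφN).symm)
  have hσ' : ∀ z, φ (σ z) = e.symm z := fun z => congrFun hσ z
  have hσopen : IsOpen (range σ) := by
    refine (IsLocalHomeomorph.of_comp (g := φ) ?_ hφ σ.continuous).isOpenMap.isOpen_range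
    rw [hσ]
    exact hsymm.isLocalHomeomorph
  have hpre : IsOpen (φ ⁻¹' e.source) := e.open_source.preimage hφ.continuous
  have hcont : ContinuousOn (fun x => (σ (e (φ x)), x)) (φ ⁻¹' e.source) :=
    (σ.continuous.comp_continuousOn (e.continuousOn.comp hφ.continuous.continuousOn
      fun _ h => h)).prodMk continuousOn_id
  have hVopen : IsOpen (φ ⁻¹' e.source ∩ (fun x => (σ (e (φ x)), x)) ⁻¹' (diagonal S2)ᶜ) :=
    hcont.isOpen_inter_preimage hpre isClosed_diagonal.isOpen_compl
  have hconn : IsPreconnected (φ ⁻¹' e.source) := by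
    rw [hsrc, preimage_compl]
    exact isPreconnected_compl_of_finite (finite_fiber_of_isLocalHomeomorph hφ N)
      (surjective_of_isLocalHomeomorph hφ N)
  -- The sheet `range σ` is open, and so is the set where `σ ∘ e ∘ φ` differs from the identity.
  -- They are disjoint and cover the connected set `φ ⁻¹' e.source`, so one sheet is everything; `φ`
  -- is injective on it.
  have hsub : φ ⁻¹' e.source ⊆ range σ := by
    refine IsPreconnected.subset_left_of_subset_union hσopen hVopen ?_ ?_ ?_ hconn
    · rw [disjoint_left]
      rintro _ ⟨z, rfl⟩ ⟨-, hz⟩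
      exact hz (by simp [hσ', hright])
    · intro x hx
      by_cases h : σ (e (φ x)) = x
      · exact Or.inl ⟨_, h⟩
      · exact Or.inr ⟨hx, h⟩
    · exact ⟨p, by simpa [hsrc] using hφN, ⟨_, hσp⟩⟩
  obtain ⟨z, rfl⟩ := hsub (show p' ∈ φ ⁻¹' e.source by simpa [hsrc, ← hpp'] using hφN)
  rw [← hσp, hpp', hσ', hright]

/-! ### Lorentzian algebra and the boost -/

/-- Euclidean plane. -/
abbrev E2 : Type := EuclideanSpace ℝ (Fin 2)

/-- Euclidean space. -/
abbrev E3 : Type := EuclideanSpace ℝ (Fin 3)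

/-- The linear functional `⟨·, u⟩`. -/
noncomputable def minkLeft (u : L4) : L4 →L[ℝ] ℝ :=
  LinearMap.toContinuousLinearMap
    { toFun := fun x => mink x u
      map_add' := fun x y => by simp only [mink, Pi.add_apply]; ring
      map_smul' := fun c x => by simp only [mink, Pi.smul_apply, smul_eq_mul, RingHom.id_apply]; ring }

@[simp]
theorem minkLeft_apply (u x : L4) : minkLeft u x = mink x u := rfl

theorem mink_comm (x y : L4) : mink x y = mink y x := by
  simp only [mink]; ring

theorem mink_add_left (x y z : L4) : mink (x + y) z = mink x z + mink y z := (minkLeft z).map_add x y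

theorem mink_sub_left (x y z : L4) : mink (x - y) z = mink x z - mink y z := (minkLeft z).map_sub x y

theorem mink_smul_left (c : ℝ) (x z : L4) : mink (c • x) z = c * mink x z :=
  (minkLeft z).map_smul c x

theorem mink_add_right (x y z : L4) : mink x (y + z) = mink x y + mink x z := by
  simp only [mink_comm x, mink_add_left]

theorem mink_smul_right (c : ℝ) (x z : L4) : mink x (c • z) = c * mink x z := by
  simp only [mink_comm x, mink_smul_left]

theorem mink_nondegenerate {x : L4} (h : ∀ z, mink x z = 0) : x = 0 := by
  funext i
  have := h (Pi.single i 1)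
  fin_cases i <;> simpa [mink] using this

/-- Cauchy-Schwarz on the spatial parts: they have squared lengths `x₀²` and `u₀² - 1`, so their
product cannot outweigh `-x₀u₀ > 0`. -/
theorem mink_pos_of_mem_futureCone {u x : L4} (hu : mink u u = -1) (hu0 : u 0 < 0)
    (hx : x ∈ futureCone) : 0 < mink x u := by
  obtain ⟨hx, hx0⟩ := hx
  simp only [mink] at *
  by_contra! h
  have h1 : x 0 * (-u 0) ≤ -(x 1 * u 1 + x 2 * u 2 + x 3 * u 3) := by linarith
  have h2 : (x 0 * (-u 0)) ^ 2 ≤ (-(x 1 * u 1 + x 2 * u 2 + x 3 * u 3)) ^ 2 :=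
    pow_le_pow_left₀ (mul_nonneg hx0.le (by linarith)) h1 2
  have h3 : (x 1 * u 1 + x 2 * u 2 + x 3 * u 3) ^ 2
      ≤ (x 1 ^ 2 + x 2 ^ 2 + x 3 ^ 2) * (u 1 ^ 2 + u 2 ^ 2 + u 3 ^ 2) := by
    nlinarith [sq_nonneg (x 1 * u 2 - x 2 * u 1), sq_nonneg (x 1 * u 3 - x 3 * u 1),
      sq_nonneg (x 2 * u 3 - x 3 * u 2)]
  have h4 : x 1 ^ 2 + x 2 ^ 2 + x 3 ^ 2 = x 0 ^ 2 := by linarith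
  have h5 : u 1 ^ 2 + u 2 ^ 2 + u 3 ^ 2 = u 0 ^ 2 - 1 := by linarith
  rw [h4, h5] at h3
  nlinarith [pow_pos hx0 2]

/-- The spatial part, in `ℝ³`, of the Lorentz boost which maps `-u` to `(1, 0, 0, 0)`. -/
noncomputable def boost (u : L4) : L4 →L[ℝ] E3 :=
  LinearMap.toContinuousLinearMap
    { toFun := fun x => WithLp.toLp 2 fun i : Fin 3 => x i.succ +
        u i.succ * (x 0 + (u 1 * x 1 + u 2 * x 2 + u 3 * x 3) / (1 - u 0))
      map_add' := fun x y => by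
        ext i; simp only [Pi.add_apply, PiLp.add_apply]; ring
      map_smul' := fun c x => by
        ext i; simp only [Pi.smul_apply, smul_eq_mul, RingHom.id_apply, PiLp.smul_apply]; ring }

theorem boost_apply (u x : L4) (i : Fin 3) : boost u x i = x i.succ +
    u i.succ * (x 0 + (u 1 * x 1 + u 2 * x 2 + u 3 * x 3) / (1 - u 0)) := rfl

/-- The boost is a Lorentz isometry whose time coordinate is `⟨x, u⟩`. -/
theorem mink_eq_boost {u : L4} (hu : mink u u = -1) (hu0 : u 0 < 0) (x y : L4) :
    mink x y = -(mink x u * mink y u) + inner ℝ (boost u x) (boost u y) := by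
  have hne : 1 - u 0 ≠ 0 := by linarith
  simp only [PiLp.inner_apply, Fin.sum_univ_three, boost_apply]
  simp only [mink] at *
  have e1 : (0 : Fin 3).succ = 1 := rfl
  have e2 : (1 : Fin 3).succ = 2 := rfl
  have e3 : (2 : Fin 3).succ = 3 := rfl
  simp only [e1, e2, e3, RCLike.inner_apply, conj_trivial]
  set s := (u 1 * x 1 + u 2 * x 2 + u 3 * x 3) / (1 - u 0) with hs
  set t := (u 1 * y 1 + u 2 * y 2 + u 3 * y 3) / (1 - u 0) with ht
  have hs' : u 1 * x 1 + u 2 * x 2 + u 3 * x 3 = s * (1 - u 0) := by rw [hs]; field_simp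
  have ht' : u 1 * y 1 + u 2 * y 2 + u 3 * y 3 = t * (1 - u 0) := by rw [ht]; field_simp
  have hx : -(x 0 * u 0) + x 1 * u 1 + x 2 * u 2 + x 3 * u 3 = -(x 0 * u 0) + s * (1 - u 0) := by
    linarith
  have hy : -(y 0 * u 0) + y 1 * u 1 + y 2 * u 2 + y 3 * u 3 = -(y 0 * u 0) + t * (1 - u 0) := by
    linarith
  rw [hx, hy]
  linear_combination (-(x 0 + s) * (y 0 + t)) * hu - (y 0 + t) * hs' - (x 0 + s) * ht'

theorem eq_of_boost_eq {u : L4} (hu : mink u u = -1) (hu0 : u 0 < 0) {x y : L4}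
    (h : mink x u = mink y u) (hb : boost u x = boost u y) : x = y := by
  refine sub_eq_zero.1 (mink_nondegenerate fun z => ?_)
  rw [mink_sub_left, mink_eq_boost hu hu0 x z, mink_eq_boost hu hu0 y z, h, hb, sub_self]

theorem norm_boost_of_null {u : L4} (hu : mink u u = -1) (hu0 : u 0 < 0) {x : L4}
    (hx : mink x x = 0) : ‖boost u x‖ = |mink x u| := by
  have h := mink_eq_boost hu hu0 x x
  rw [hx, real_inner_self_eq_norm_sq] at h
  rw [← abs_of_nonneg (norm_nonneg (boost u x)), ← sq_eq_sq_iff_abs_eq_abs]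
  linarith

/-! ### Volumes of cones in `ℝ³` -/

/-- The projection `(x₀, x₁, x₂) ↦ (x₁, x₂)`. -/
noncomputable def tailProj : E3 →L[ℝ] E2 :=
  LinearMap.toContinuousLinearMap
    { toFun := fun x => WithLp.toLp 2 fun i : Fin 2 => x i.succ
      map_add' := fun x y => by ext i; simp
      map_smul' := fun c x => by ext i; simp }

theorem tailProj_apply (x : E3) (i : Fin 2) : tailProj x i = x i.succ := rfl

theorem measurePreserving_head_tailProj :
    MeasurePreserving (fun x : E3 => (x 0, tailProj x)) volume volume := by
  have h1 := PiLp.volume_preserving_ofLp (Fin 3)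
  have h2 := volume_preserving_piFinSuccAbove (fun _ : Fin 3 => ℝ) 0
  have h3 := PiLp.volume_preserving_toLp (Fin 2)
  exact (((MeasurePreserving.id volume).prod h3).comp h2).comp h1

theorem lintegral_sq_Ioo : ∫⁻ t in Ioo (0 : ℝ) 1, ENNReal.ofReal (t ^ 2) = ENNReal.ofReal (1 / 3) := by
  rw [← ofReal_integral_eq_lintegral_ofReal]
  · rw [← integral_Ioc_eq_integral_Ioo, ← intervalIntegral.integral_of_le zero_le_one, integral_pow]
    norm_num
  · exact ((continuous_pow 2).integrableOn_Icc (a := (0 : ℝ)) (b := 1)).mono_set Ioo_subset_Icc_self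
  · exact Filter.Eventually.of_forall fun t => sq_nonneg t

/-- The cylinder `(0, 1) × B` in `ℝ³`. -/
def cylinder (B : Set E2) : Set E3 := {x | x 0 ∈ Ioo (0 : ℝ) 1 ∧ tailProj x ∈ B}

theorem measurableSet_cylinder {B : Set E2} (hB : MeasurableSet B) : MeasurableSet (cylinder B) :=
  measurePreserving_head_tailProj.measurable (measurableSet_Ioo.prod hB)

/-- Fubini; the factor `1 / 3` is `∫ t² dt` over `(0, 1)`. -/
theorem lintegral_cylinder {B : Set E2} (hB : MeasurableSet B) {J : E2 → ℝ} (hJ : Measurable J) :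
    ∫⁻ x in cylinder B, ENNReal.ofReal (x 0 ^ 2 * J (tailProj x))
      = ENNReal.ofReal (1 / 3) * ∫⁻ y in B, ENNReal.ofReal (J y) := by
  have h := measurePreserving_head_tailProj.setLIntegral_comp_preimage
    (measurableSet_Ioo.prod hB) (f := fun q : ℝ × E2 => ENNReal.ofReal (q.1 ^ 2 * J q.2))
    (by fun_prop) (s := Ioo (0 : ℝ) 1 ×ˢ B)
  refine Eq.trans h ?_
  rw [Measure.volume_eq_prod, ← Measure.prod_restrict, ← lintegral_sq_Ioo,
    ← lintegral_prod_mul (by fun_prop) (by fun_prop)]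
  exact lintegral_congr fun q => ENNReal.ofReal_mul (sq_nonneg _)

/-- The parametrization `(t, y) ↦ t f(y)` of the cone over the image of `f`. -/
noncomputable def coneMap (f : E2 → E3) (x : E3) : E3 := x 0 • f (tailProj x)

/-- The derivative of `coneMap f` at `(t, y)`, where `f` has the value `a` and the derivative `f'`
at `y`. -/
noncomputable def coneMapDeriv (t : ℝ) (a : E3) (f' : E2 →L[ℝ] E3) : E3 →L[ℝ] E3 :=
  t • f'.comp tailProj + (EuclideanSpace.proj (0 : Fin 3) : E3 →L[ℝ] ℝ).smulRight a

theorem coneMapDeriv_apply (t : ℝ) (a : E3) (f' : E2 →L[ℝ] E3) (v : E3) :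
    coneMapDeriv t a f' v = t • f' (tailProj v) + v 0 • a := rfl

theorem hasStrictFDerivAt_coneMap {f : E2 → E3} {f' : E2 →L[ℝ] E3} {x : E3}
    (hf : HasStrictFDerivAt f f' (tailProj x)) :
    HasStrictFDerivAt (coneMap f) (coneMapDeriv (x 0) (f (tailProj x)) f') x :=
  (EuclideanSpace.proj (0 : Fin 3) : E3 →L[ℝ] ℝ).hasStrictFDerivAt.smul
    (hf.comp x tailProj.hasStrictFDerivAt)

/-- The area of the parallelogram spanned by the images of the two unit vectors under `f'`. -/
noncomputable def parallelogramArea (f' : E2 →L[ℝ] E3) : ℝ :=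
  Real.sqrt (inner ℝ (f' (EuclideanSpace.single 0 1)) (f' (EuclideanSpace.single 0 1))
    * inner ℝ (f' (EuclideanSpace.single 1 1)) (f' (EuclideanSpace.single 1 1))
    - inner ℝ (f' (EuclideanSpace.single 0 1)) (f' (EuclideanSpace.single 1 1)) ^ 2)

theorem parallelogramArea_nonneg (f' : E2 →L[ℝ] E3) : 0 ≤ parallelogramArea f' :=
  Real.sqrt_nonneg _

theorem inner_E3 (a b : E3) : inner ℝ a b = a 0 * b 0 + a 1 * b 1 + a 2 * b 2 := by
  simp only [PiLp.inner_apply, Fin.sum_univ_three, RCLike.inner_apply, conj_trivial]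
  ring

/-- The columns are `a`, `t b`, `t c`, and the squared determinant is their Gram determinant. It
splits because `a` is a unit vector orthogonal to `b` and `c`. -/
theorem abs_det_coneMapDeriv (t : ℝ) {a : E3} {f' : E2 →L[ℝ] E3} (ha : ‖a‖ = 1)
    (hf' : ∀ v, inner ℝ a (f' v) = 0) :
    |(coneMapDeriv t a f').det| = t ^ 2 * parallelogramArea f' := by
  have haa : inner ℝ a a = (1 : ℝ) := by rw [real_inner_self_eq_norm_sq, ha, one_pow]
  have e0 : tailProj (EuclideanSpace.single 0 1) = 0 := by
    ext i; fin_cases i <;> simp [tailProj_apply]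
  have e1 : tailProj (EuclideanSpace.single 1 1) = EuclideanSpace.single 0 1 := by
    ext i; fin_cases i <;> simp [tailProj_apply]
  have e2 : tailProj (EuclideanSpace.single 2 1) = EuclideanSpace.single 1 1 := by
    ext i; fin_cases i <;> simp [tailProj_apply]
  set b := f' (EuclideanSpace.single 0 1) with hb
  set c := f' (EuclideanSpace.single 1 1) with hc
  have c0 : coneMapDeriv t a f' (EuclideanSpace.single 0 1) = a := by
    simp [coneMapDeriv_apply, e0]
  have c1 : coneMapDeriv t a f' (EuclideanSpace.single 1 1) = t • b := by
    simp [coneMapDeriv_apply, e1, hb]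
  have c2 : coneMapDeriv t a f' (EuclideanSpace.single 2 1) = t • c := by
    simp [coneMapDeriv_apply, e2, hc]
  have hdet : (coneMapDeriv t a f').det
      = a 0 * (t * b 1) * (t * c 2) - a 0 * (t * c 1) * (t * b 2)
        - (t * b 0) * a 1 * (t * c 2) + (t * b 0) * (t * c 1) * a 2
        + (t * c 0) * a 1 * (t * b 2) - (t * c 0) * (t * b 1) * a 2 := by
    rw [ContinuousLinearMap.det, ← LinearMap.det_toMatrix (EuclideanSpace.basisFun (Fin 3) ℝ).toBasis,
      Matrix.det_fin_three]
    simp only [LinearMap.toMatrix_apply, OrthonormalBasis.coe_toBasis,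
      EuclideanSpace.basisFun_apply, ContinuousLinearMap.coe_coe, c0, c1, c2,
      OrthonormalBasis.coe_toBasis_repr_apply, EuclideanSpace.basisFun_repr, PiLp.smul_apply,
      smul_eq_mul]
  have hab : inner ℝ a b = (0 : ℝ) := hf' _
  have hac : inner ℝ a c = (0 : ℝ) := hf' _
  have hsq : (coneMapDeriv t a f').det ^ 2
      = (t ^ 2) ^ 2 * (inner ℝ b b * inner ℝ c c - inner ℝ b c ^ 2) := by
    have hgram : (coneMapDeriv t a f').det ^ 2 = (t ^ 2) ^ 2 *
        (inner ℝ a a * (inner ℝ b b * inner ℝ c c - inner ℝ b c ^ 2)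
          - inner ℝ a b * (inner ℝ a b * inner ℝ c c - inner ℝ b c * inner ℝ a c)
          + inner ℝ a c * (inner ℝ a b * inner ℝ b c - inner ℝ b b * inner ℝ a c)) := by
      rw [hdet]
      simp only [inner_E3]
      ring
    rw [hgram, haa, hab, hac]
    ring
  rw [← Real.sqrt_sq_eq_abs, hsq, Real.sqrt_mul (sq_nonneg _), Real.sqrt_sq (sq_nonneg _)]
  rfl

theorem coneMapDeriv_injective {t : ℝ} (ht : t ≠ 0) {a : E3} {f' : E2 →L[ℝ] E3} (ha : ‖a‖ = 1)
    (hf' : ∀ v, inner ℝ a (f' v) = 0) (hinj : ∀ v, v ≠ 0 → f' v ≠ 0) :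
    Function.Injective (coneMapDeriv t a f') := by
  rw [injective_iff_map_eq_zero]
  intro v hv
  rw [coneMapDeriv_apply] at hv
  have h0 : v 0 = 0 := by
    have := congrArg (fun w => inner ℝ a w) hv
    simpa [inner_add_right, inner_smul_right, hf', ha] using this
  have h1 : tailProj v = 0 := by
    by_contra h
    apply hinj _ h
    simpa [h0, ht] using hv
  ext i
  refine Fin.cases h0 (fun j => ?_) i
  simpa [tailProj_apply] using congrArg (fun w : E2 => w j) h1

theorem injOn_coneMap {f : E2 → E3} {B : Set E2} (hunit : ∀ y ∈ B, ‖f y‖ = 1) (hinj : InjOn f B) :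
    InjOn (coneMap f) (cylinder B) := by
  rintro x ⟨hx0, hx⟩ y ⟨hy0, hy⟩ hxy
  have h0 : x 0 = y 0 := by
    have := congrArg norm hxy
    simpa [coneMap, norm_smul, hunit _ hx, hunit _ hy, abs_of_pos hx0.1, abs_of_pos hy0.1] using this
  have h1 : tailProj x = tailProj y := by
    refine hinj hx hy (smul_right_injective E3 hx0.1.ne' ?_)
    simpa only [coneMap, ← h0] using hxy
  ext i
  refine Fin.cases h0 (fun j => ?_) i
  simpa [tailProj_apply] using congrArg (fun w : E2 => w j) h1

/-- The volume of the cone over a parametrized piece of the unit sphere is a third of the area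
of that piece. -/
theorem volume_image_coneMap {f : E2 → E3} {f' : E2 → E2 →L[ℝ] E3} {B : Set E2}
    (hB : MeasurableSet B) (hf : ∀ y ∈ B, HasStrictFDerivAt f (f' y) y)
    (hf'm : Measurable fun y => parallelogramArea (f' y))
    (hunit : ∀ y ∈ B, ‖f y‖ = 1) (horth : ∀ y ∈ B, ∀ v, inner ℝ (f y) (f' y v) = 0)
    (hinj : InjOn f B) :
    volume (coneMap f '' cylinder B)
      = ENNReal.ofReal (1 / 3) * ∫⁻ y in B, ENNReal.ofReal (parallelogramArea (f' y)) := by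
  rw [← lintegral_cylinder hB hf'm,
    ← lintegral_abs_det_fderiv_eq_addHaar_image volume (measurableSet_cylinder hB)
      (fun x hx => (hasStrictFDerivAt_coneMap (hf _ hx.2)).hasFDerivAt.hasFDerivWithinAt)
      (injOn_coneMap hunit hinj)]
  refine setLIntegral_congr_fun (measurableSet_cylinder hB) fun x hx => ?_
  simp only
  rw [abs_det_coneMapDeriv _ (hunit _ hx.2) (horth _ hx.2)]

/-! ### Coordinates and the conformal projection along light rays -/

section Charts

variable {M : Type*} [TopologicalSpace M] [ChartedSpace (EuclideanSpace ℝ (Fin 2)) M]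
  [IsManifold (𝓡 2) ∞ M]

theorem contDiffOn_comp_chart_symm {ψ : M → L4} (hψ : ContMDiff (𝓡 2) 𝓘(ℝ, L4) ∞ ψ) (c : M) :
    ContDiffOn ℝ ∞ (ψ ∘ (chartAt E2 c).symm) (chartAt E2 c).target :=
  (hψ.comp_contMDiffOn (contMDiffOn_chart_symm (I := 𝓡 2) (n := ∞) (x := c))).contDiffOn

theorem mink_fderiv_comp_chart_symm_pos {ψ : M → L4} (hψ : IsSpacelikeImmersion ψ) (c : M)
    {y : E2} (hy : y ∈ (chartAt E2 c).target) {v : E2} (hv : v ≠ 0) :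
    0 < mink (fderiv ℝ (ψ ∘ (chartAt E2 c).symm) y v)
      (fderiv ℝ (ψ ∘ (chartAt E2 c).symm) y v) := by
  have : IsManifold (𝓡 2) 1 M := IsManifold.of_le (n := ∞) (by simp)
  have he := (mdifferentiable_chart (I := 𝓡 2) c).symm
  have hy' : y ∈ (chartAt E2 c).symm.source := hy
  have hinj := (he.mfderiv_bijective hy').1
  have hd : MDifferentiableAt (𝓡 2) 𝓘(ℝ, L4) ψ ((chartAt E2 c).symm y) :=
    (hψ.1 _).mdifferentiableAt (by simp)
  have hcomp := mfderiv_comp y hd (he.mdifferentiableAt hy')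
  rw [← mfderiv_eq_fderiv, hcomp]
  exact hψ.2 _ _ fun h => hv (hinj (h.trans (map_zero _).symm))

end Charts

/-- The projection of `ψ` along the rays of the lightcone to the unit sphere orthogonal to `u`. -/
noncomputable def direction {M : Type*} (u : L4) (ψ : M → L4) (p : M) : E3 :=
  (mink (ψ p) u)⁻¹ • boost u (ψ p)

section Direction

variable {M : Type*} {ψ : M → L4} {u : L4}

theorem smul_direction (hu : mink u u = -1) (hu0 : u 0 < 0) (hcone : ∀ p, ψ p ∈ futureCone)
    (p : M) : mink (ψ p) u • direction u ψ p = boost u (ψ p) :=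
  smul_inv_smul₀ (mink_pos_of_mem_futureCone hu hu0 (hcone p)).ne' _

theorem norm_direction (hu : mink u u = -1) (hu0 : u 0 < 0) (hcone : ∀ p, ψ p ∈ futureCone)
    (p : M) : ‖direction u ψ p‖ = 1 := by
  have hpos := mink_pos_of_mem_futureCone hu hu0 (hcone p)
  rw [direction, norm_smul, norm_boost_of_null hu hu0 (hcone p).1, norm_inv, Real.norm_eq_abs,
    inv_mul_cancel₀ (abs_pos.2 hpos.ne').ne']

theorem continuous_direction [TopologicalSpace M] (hu : mink u u = -1) (hu0 : u 0 < 0)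
    (hcone : ∀ p, ψ p ∈ futureCone) (hψ : Continuous ψ) : Continuous (direction u ψ) :=
  (((minkLeft u).continuous.comp hψ).inv₀
    fun p => (mink_pos_of_mem_futureCone hu hu0 (hcone p)).ne').smul ((boost u).continuous.comp hψ)

variable {g : E2 → L4} {y : E2}

theorem contDiffAt_direction (hu : mink u u = -1) (hu0 : u 0 < 0) (hg : ContDiffAt ℝ ∞ g y)
    (hcone : ∀ z, g z ∈ futureCone) : ContDiffAt ℝ ∞ (direction u g) y :=
  (((minkLeft u).contDiff.contDiffAt.comp y hg).inv
    (mink_pos_of_mem_futureCone hu hu0 (hcone y)).ne').smul ((boost u).contDiff.contDiffAt.comp y hg)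

/-- Differentiate `‖direction‖² = 1`. -/
theorem inner_direction_fderiv (hu : mink u u = -1) (hu0 : u 0 < 0) (hg : ContDiffAt ℝ ∞ g y)
    (hcone : ∀ z, g z ∈ futureCone) (v : E2) :
    inner ℝ (direction u g y) (fderiv ℝ (direction u g) y v) = 0 := by
  have hd : HasFDerivAt (direction u g) (fderiv ℝ (direction u g) y) y :=
    ((contDiffAt_direction hu hu0 hg hcone).differentiableAt (by simp)).hasFDerivAt
  have h1 := hd.inner ℝ hd
  have h2 : HasFDerivAt (fun z => inner ℝ (direction u g z) (direction u g z)) (0 : E2 →L[ℝ] ℝ) y := by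
    simp only [real_inner_self_eq_norm_sq, norm_direction hu hu0 hcone]
    exact hasFDerivAt_const _ _
  have h3 := congrArg (fun L : E2 →L[ℝ] ℝ => L v) (h1.unique h2)
  simp [real_inner_comm] at h3
  linarith

/-- The metric induced by `g` is conformal to the one induced by its direction. -/
theorem mink_fderiv_eq_direction (hu : mink u u = -1) (hu0 : u 0 < 0) (hg : ContDiffAt ℝ ∞ g y)
    (hcone : ∀ z, g z ∈ futureCone) (v w : E2) :
    mink (fderiv ℝ g y v) (fderiv ℝ g y w) = mink (g y) u ^ 2 *
      inner ℝ (fderiv ℝ (direction u g) y v) (fderiv ℝ (direction u g) y w) := by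
  have hd : HasFDerivAt (direction u g) (fderiv ℝ (direction u g) y) y :=
    ((contDiffAt_direction hu hu0 hg hcone).differentiableAt (by simp)).hasFDerivAt
  have hg' : HasFDerivAt g (fderiv ℝ g y) y := (hg.differentiableAt (by simp)).hasFDerivAt
  have h1 : HasFDerivAt (fun z => boost u (g z)) ((boost u).comp (fderiv ℝ g y)) y :=
    (boost u).hasFDerivAt.comp y hg'
  have hm : HasFDerivAt (fun z => mink (g z) u) ((minkLeft u).comp (fderiv ℝ g y)) y :=
    (minkLeft u).hasFDerivAt.comp y hg'
  have h2 := hm.smul hd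
  have hfun : (fun z => mink (g z) u) • direction u g = fun z => boost u (g z) :=
    funext fun z => smul_direction hu hu0 hcone z
  -- Product rule for `boost u ∘ g = h · direction`, with `h = ⟨g, u⟩`. In `mink_eq_boost` the term
  -- `dh(v) dh(w)` then occurs once with each sign and cancels.
  have h3 : ∀ v, boost u (fderiv ℝ g y v)
      = mink (g y) u • fderiv ℝ (direction u g) y v + mink (fderiv ℝ g y v) u • direction u g y := by
    intro v
    rw [hfun] at h2
    exact congrArg (fun L : E2 →L[ℝ] E3 => L v) (h1.unique h2)
  have h4 := inner_direction_fderiv hu hu0 hg hcone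
  have h5 : inner ℝ (direction u g y) (direction u g y) = (1 : ℝ) := by
    rw [real_inner_self_eq_norm_sq, norm_direction hu hu0 hcone, one_pow]
  have h6 : ∀ v, inner ℝ (fderiv ℝ (direction u g) y v) (direction u g y) = (0 : ℝ) := fun v => by
    rw [real_inner_comm, h4]
  rw [mink_eq_boost hu hu0, h3, h3]
  simp only [inner_add_left, inner_add_right, real_inner_smul_left, real_inner_smul_right, h4, h5, h6]
  ring

end Direction

/-! ### The projection is a bijection of spheres -/

/-- The embedding `y ↦ (1, y)`. -/
noncomputable def consOne (y : E2) : E3 := WithLp.toLp 2 (Fin.cons 1 fun i => y i)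

theorem consOne_zero (y : E2) : consOne y 0 = 1 := rfl

theorem tailProj_consOne (y : E2) : tailProj (consOne y) = y := rfl

theorem continuous_consOne : Continuous consOne := by
  refine (PiLp.continuous_toLp 2 _).comp (continuous_pi fun i => ?_)
  refine Fin.cases ?_ (fun j => ?_) i
  · exact continuous_const
  · simp only [Fin.cons_succ]
    fun_prop

theorem coneMap_consOne (f : E2 → E3) (y : E2) : coneMap f (consOne y) = f y := by
  simp [coneMap, consOne_zero, tailProj_consOne]

section

variable {ψ : S2 → L4} {u : L4}

/-- `direction` as a map between spheres. -/
noncomputable def directionSphere (hu : mink u u = -1) (hu0 : u 0 < 0)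
    (hcone : ∀ p, ψ p ∈ futureCone) (p : S2) : S2 :=
  ⟨direction u ψ p, by simp [norm_direction hu hu0 hcone]⟩

theorem contDiffAt_comp_chart_symm (hψ : IsSpacelikeImmersion ψ) (c : S2) {y : E2}
    (hy : y ∈ (chartAt E2 c).target) : ContDiffAt ℝ ∞ (ψ ∘ (chartAt E2 c).symm) y :=
  (contDiffOn_comp_chart_symm hψ.1 c).contDiffAt ((chartAt E2 c).open_target.mem_nhds hy)

theorem hasStrictFDerivAt_direction (hψ : IsSpacelikeImmersion ψ) (hu : mink u u = -1)
    (hu0 : u 0 < 0) (hcone : ∀ p, ψ p ∈ futureCone) (c : S2) {y : E2}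
    (hy : y ∈ (chartAt E2 c).target) :
    HasStrictFDerivAt (direction u (ψ ∘ (chartAt E2 c).symm))
      (fderiv ℝ (direction u (ψ ∘ (chartAt E2 c).symm)) y) y :=
  (contDiffAt_direction hu hu0 (contDiffAt_comp_chart_symm hψ c hy)
    fun _ => hcone _).hasStrictFDerivAt (by simp)

theorem fderiv_direction_ne_zero (hψ : IsSpacelikeImmersion ψ) (hu : mink u u = -1)
    (hu0 : u 0 < 0) (hcone : ∀ p, ψ p ∈ futureCone) (c : S2) {y : E2}
    (hy : y ∈ (chartAt E2 c).target) {v : E2} (hv : v ≠ 0) :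
    fderiv ℝ (direction u (ψ ∘ (chartAt E2 c).symm)) y v ≠ 0 := by
  intro h
  have hpos := mink_fderiv_comp_chart_symm_pos hψ c hy hv
  rw [mink_fderiv_eq_direction hu hu0 (contDiffAt_comp_chart_symm hψ c hy) (fun _ => hcone _), h]
    at hpos
  simp at hpos

/-- The inverse function theorem is applied to the cone map `(t, y) ↦ t f(y)` between open sets of
`ℝ³`, at `t = 1`, rather than to a map into the sphere. Restricting to `t = 1` recovers injectivity
and openness of `direction`. -/
theorem isLocalHomeomorph_directionSphere (hψ : IsSpacelikeImmersion ψ) (hu : mink u u = -1)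
    (hu0 : u 0 < 0) (hcone : ∀ p, ψ p ∈ futureCone) :
    IsLocalHomeomorph (directionSphere hu hu0 hcone) := by
  have hcont : Continuous (directionSphere hu hu0 hcone) :=
    (continuous_direction hu hu0 hcone hψ.1.continuous).subtype_mk _
  rw [isLocalHomeomorph_iff_isOpenEmbedding_restrict]
  intro p
  set e := chartAt E2 p with he
  set f := direction u (ψ ∘ e.symm) with hf
  have hfe : ∀ q ∈ e.source, f (e q) = directionSphere hu hu0 hcone q := fun q hq => by
    simp [hf, direction, directionSphere, e.left_inv hq]
  have hp : e p ∈ e.target := e.map_source (mem_chart_source E2 p)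
  -- This holds on the whole plane: outside its target the chart inverse still takes values in the
  -- sphere.
  have hnorm : ∀ y, ‖f y‖ = 1 := norm_direction hu hu0 fun _ => hcone _
  have hinj := coneMapDeriv_injective (t := consOne (e p) 0) (by simp [consOne_zero]) (hnorm (e p))
    (inner_direction_fderiv hu hu0 (contDiffAt_comp_chart_symm hψ p hp) fun _ => hcone _)
    (fun v => fderiv_direction_ne_zero hψ hu hu0 hcone p hp)
  have hstrict := hasStrictFDerivAt_coneMap (x := consOne (e p))
    (hasStrictFDerivAt_direction hψ hu hu0 hcone p hp)
  set L : E3 ≃L[ℝ] E3 := (LinearEquiv.ofInjectiveEndo _ hinj).toContinuousLinearEquiv with hL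
  have hstrict' : HasStrictFDerivAt (coneMap f) (L : E3 →L[ℝ] E3) (consOne (e p)) := hstrict
  set Φ := hstrict'.toOpenPartialHomeomorph (coneMap f) with hΦ
  have hΦc : ⇑Φ = coneMap f := hstrict'.toOpenPartialHomeomorph_coe
  have hpΦ : consOne (e p) ∈ Φ.source := hstrict'.mem_toOpenPartialHomeomorph_source
  have hWopen : IsOpen (Φ.source ∩ {x | 0 < x 0}) :=
    Φ.open_source.inter (isOpen_lt continuous_const (by fun_prop))
  set W : Set E3 := Φ.source ∩ {x | 0 < x 0} with hW
  set U : Set S2 := e.source ∩ e ⁻¹' (consOne ⁻¹' W) with hU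
  have hUopen : IsOpen U := e.isOpen_inter_preimage (hWopen.preimage continuous_consOne)
  refine ⟨U, hUopen.mem_nhds ⟨mem_chart_source E2 p, hpΦ, by simp [consOne_zero]⟩, ?_⟩
  refine .of_continuous_injective_isOpenMap (hcont.comp continuous_subtype_val) ?_ ?_
  · rintro ⟨q, hq⟩ ⟨q', hq'⟩ hqq'
    have h1 : f (e q) = f (e q') := by
      rw [hfe q hq.1, hfe q' hq'.1]
      exact congrArg Subtype.val hqq'
    have h2 : consOne (e q) = consOne (e q') := by
      refine Φ.injOn hq.2.1 hq'.2.1 ?_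
      rw [hΦc, coneMap_consOne, coneMap_consOne, h1]
    have h3 : e q = e q' := by rw [← tailProj_consOne (e q), h2, tailProj_consOne]
    exact Subtype.ext (e.injOn hq.1 hq'.1 h3)
  · intro s hs
    set V : Set S2 := Subtype.val '' s with hV
    have hVopen : IsOpen V := hUopen.isOpenMap_subtype_val s hs
    set O : Set E3 := W ∩ tailProj ⁻¹' (e.target ∩ e.symm ⁻¹' V) with hO
    have hOopen : IsOpen O := hWopen.inter
      ((e.isOpen_inter_preimage_symm hVopen).preimage tailProj.continuous)
    have himage : IsOpen (coneMap f '' O) := by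
      rw [← hΦc]
      exact Φ.isOpen_image_of_subset_source hOopen fun x hx => hx.1.1
    -- On the half space `x 0 > 0`, the cone map meets the unit sphere only where `x 0 = 1`, since
    -- its norm there is `x 0`.
    have heq : U.domRestrict (directionSphere hu hu0 hcone) '' s
        = Subtype.val ⁻¹' (coneMap f '' O) := by
      ext z
      constructor
      · rintro ⟨q, hq, rfl⟩
        refine ⟨consOne (e q), ⟨q.2.2, ?_⟩, ?_⟩
        · refine ⟨e.map_source q.2.1, ?_⟩
          rw [mem_preimage, tailProj_consOne, e.left_inv q.2.1]
          exact ⟨q, hq, rfl⟩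
        · rw [coneMap_consOne, hfe _ q.2.1]
          rfl
      · rintro ⟨x, ⟨⟨-, hx0⟩, hxt, q, hq, hqx⟩, hxz⟩
        refine ⟨q, hq, Subtype.ext ?_⟩
        have hx1 : x 0 = 1 := by
          have := congrArg norm hxz
          rw [coneMap, norm_smul, hnorm, norm_eq_of_mem_sphere z, mul_one, Real.norm_eq_abs,
            abs_of_pos hx0] at this
          exact this
        rw [← hxz, coneMap, hx1, one_smul, domRestrict_apply, ← hfe _ q.2.1, hqx, e.right_inv hxt]
    rw [heq]
    exact himage.preimage continuous_subtype_val

theorem direction_injective (hψ : IsSpacelikeImmersion ψ) (hu : mink u u = -1)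
    (hu0 : u 0 < 0) (hcone : ∀ p, ψ p ∈ futureCone) : Function.Injective (direction u ψ) :=
  Subtype.val_injective.comp
    (injective_of_isLocalHomeomorph (isLocalHomeomorph_directionSphere hψ hu hu0 hcone))

theorem exists_direction_eq (hψ : IsSpacelikeImmersion ψ) (hu : mink u u = -1)
    (hu0 : u 0 < 0) (hcone : ∀ p, ψ p ∈ futureCone) {x : E3} (hx : ‖x‖ = 1) :
    ∃ p, direction u ψ p = x := by
  obtain ⟨p, hp⟩ := surjective_of_isLocalHomeomorph
    (isLocalHomeomorph_directionSphere hψ hu hu0 hcone) ⟨x, by simpa using hx⟩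
  exact ⟨p, congrArg Subtype.val hp⟩

end

/-! ### The area measure through volumes of cones -/

/-- The part in the open unit ball of the cone over `d(S)`, without its apex. -/
def coneOver (d : S2 → E3) (S : Set S2) : Set E3 := {x | ∃ p ∈ S, ∃ t ∈ Ioo (0 : ℝ) 1, x = t • d p}

theorem coneOver_iUnion {ι : Sort*} (d : S2 → E3) (S : ι → Set S2) :
    coneOver d (⋃ i, S i) = ⋃ i, coneOver d (S i) := by
  ext x
  simp only [coneOver, mem_iUnion, mem_ofPred_eq]
  constructor
  · rintro ⟨p, ⟨i, hi⟩, h⟩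
    exact ⟨i, p, hi, h⟩
  · rintro ⟨i, p, hi, h⟩
    exact ⟨p, ⟨i, hi⟩, h⟩

theorem disjoint_coneOver {d : S2 → E3} (hd : ∀ p, ‖d p‖ = 1) (hinj : Function.Injective d)
    {S T : Set S2} (h : Disjoint S T) : Disjoint (coneOver d S) (coneOver d T) := by
  rw [disjoint_left] at h ⊢
  rintro _ ⟨p, hp, t, ht, rfl⟩ ⟨q, hq, s, hs, hpq⟩
  have hts : t = s := by
    have := congrArg norm hpq
    simpa [norm_smul, hd, abs_of_pos ht.1, abs_of_pos hs.1] using this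
  rw [← hts] at hpq
  rw [hinj (smul_right_injective E3 ht.1.ne' hpq)] at hp
  exact h hp hq

theorem coneOver_univ {d : S2 → E3} (hd : ∀ p, ‖d p‖ = 1) (hsurj : ∀ x : E3, ‖x‖ = 1 → ∃ p, d p = x) :
    coneOver d univ = Metric.ball 0 1 \ {0} := by
  ext x
  constructor
  · rintro ⟨p, -, t, ht, rfl⟩
    have hp : d p ≠ 0 := fun h => by simpa [h] using hd p
    refine ⟨?_, smul_ne_zero ht.1.ne' hp⟩
    rw [mem_ball_zero_iff, norm_smul, hd, mul_one, Real.norm_eq_abs, abs_of_pos ht.1]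
    exact ht.2
  · rintro ⟨hx, hx0⟩
    have hpos : 0 < ‖x‖ := norm_pos_iff.2 hx0
    obtain ⟨p, hp⟩ := hsurj (‖x‖⁻¹ • x) (by rw [norm_smul, norm_inv, norm_norm, inv_mul_cancel₀ hpos.ne'])
    refine ⟨p, mem_univ _, ‖x‖, ⟨hpos, mem_ball_zero_iff.1 hx⟩, ?_⟩
    rw [hp, smul_inv_smul₀ hpos.ne']

section Area

variable {ψ : S2 → L4} {u : L4}

theorem measurableSet_target_inter_preimage (e : OpenPartialHomeomorph S2 E2) {S : Set S2}
    (hS : MeasurableSet S) : MeasurableSet (e.target ∩ e.symm ⁻¹' S) := by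
  have h := e.open_target.measurableSet.subtype_image
    ((continuousOn_iff_continuous_domRestrict.1 e.continuousOn_symm).measurable hS)
  convert h using 1
  ext y
  simp [domRestrict, and_comm]

theorem measurable_areaDensity (ψ : S2 → L4) (e : OpenPartialHomeomorph S2 E2) :
    Measurable (areaDensity ψ e) := by
  have h : ∀ i j : Fin 2, Measurable fun y => mink (coordDeriv ψ e i y) (coordDeriv ψ e j y) := by
    intro i j
    have h1 : ∀ i, Measurable (coordDeriv ψ e i) := fun i => measurable_fderiv_apply_const ℝ _ _
    have h2 : ∀ i k, Measurable fun y => coordDeriv ψ e i y k :=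
      fun i k => (measurable_pi_apply k).comp (h1 i)
    simp only [mink]
    exact (((((h2 i 0).mul (h2 j 0)).neg).add ((h2 i 1).mul (h2 j 1))).add
      ((h2 i 2).mul (h2 j 2))).add ((h2 i 3).mul (h2 j 3))
  exact (((h 0 0).mul (h 1 1)).sub ((h 0 1).pow_const 2)).sqrt

theorem setLIntegral_chartArea (ψ : S2 → L4) (e : OpenPartialHomeomorph S2 E2) {S : Set S2}
    (hS : MeasurableSet S) {G : S2 → ℝ≥0∞} (hG : Measurable G) :
    ∫⁻ p in S, G p ∂(chartArea ψ e)
      = ∫⁻ y in e.target ∩ e.symm ⁻¹' S, ENNReal.ofReal (areaDensity ψ e y) * G (e.symm y) := by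
  have hd : Measurable fun y => ENNReal.ofReal (areaDensity ψ e y) :=
    (measurable_areaDensity ψ e).ennreal_ofReal
  have he : AEMeasurable e.symm (volume.restrict e.target) :=
    e.continuousOn_symm.aemeasurable e.open_target.measurableSet
  have he' : AEMeasurable e.symm ((volume.restrict e.target).withDensity
      fun y => ENNReal.ofReal (areaDensity ψ e y)) :=
    he.mono_ac (withDensity_absolutelyContinuous _ _)
  have hmul := lintegral_withDensity_eq_lintegral_mul₀ hd.aemeasurable
    ((hG.indicator hS).comp_aemeasurable he)
  rw [← lintegral_indicator hS, chartArea, lintegral_map' (hG.indicator hS).aemeasurable he']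
  refine hmul.trans ?_
  rw [← lintegral_indicator e.open_target.measurableSet,
    ← lintegral_indicator (measurableSet_target_inter_preimage e hS)]
  refine lintegral_congr fun y => ?_
  by_cases h1 : y ∈ e.target <;> by_cases h2 : e.symm y ∈ S <;> simp [h1, h2]

theorem measurable_parallelogramArea_fderiv (f : E2 → E3) :
    Measurable fun y => parallelogramArea (fderiv ℝ f y) := by
  have h1 : ∀ v, Measurable fun y => fderiv ℝ f y v := fun v => measurable_fderiv_apply_const ℝ _ _
  unfold parallelogramArea
  exact ((((h1 _).inner (h1 _)).mul ((h1 _).inner (h1 _))).sub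
    (((h1 _).inner (h1 _)).pow_const 2)).sqrt

/-- A conformal factor `k = h²` multiplies `EG - F²` by `k²`, hence the density by `k`. -/
theorem areaDensity_eq (hψ : IsSpacelikeImmersion ψ) (hu : mink u u = -1) (hu0 : u 0 < 0)
    (hcone : ∀ p, ψ p ∈ futureCone) (c : S2) {y : E2} (hy : y ∈ (chartAt E2 c).target) :
    areaDensity ψ (chartAt E2 c) y = mink (ψ ((chartAt E2 c).symm y)) u ^ 2 *
      parallelogramArea (fderiv ℝ (direction u (ψ ∘ (chartAt E2 c).symm)) y) := by
  have h := mink_fderiv_eq_direction hu hu0 (contDiffAt_comp_chart_symm hψ c hy) (fun _ => hcone _)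
  simp only [areaDensity, coordDeriv, parallelogramArea]
  rw [h, h, h, Function.comp_apply]
  set k := mink (ψ ((chartAt E2 c).symm y)) u ^ 2 with hk
  conv_rhs => rw [← Real.sqrt_sq (show 0 ≤ k from sq_nonneg _), ← Real.sqrt_mul (sq_nonneg k)]
  congr 1
  ring

theorem coneMap_image_cylinder (c : S2) {S : Set S2} (hS : S ⊆ (chartAt E2 c).source) :
    coneMap (direction u (ψ ∘ (chartAt E2 c).symm)) ''
        cylinder ((chartAt E2 c).target ∩ (chartAt E2 c).symm ⁻¹' S)
      = coneOver (direction u ψ) S := by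
  ext x
  constructor
  · rintro ⟨x, ⟨hx0, -, hx⟩, rfl⟩
    exact ⟨_, hx, x 0, hx0, rfl⟩
  · rintro ⟨p, hp, t, ht, rfl⟩
    refine ⟨WithLp.toLp 2 (Fin.cons t fun i => chartAt E2 c p i), ⟨ht, ?_, ?_⟩, ?_⟩
    · exact (chartAt E2 c).map_source (hS hp)
    · change (chartAt E2 c).symm (chartAt E2 c p) ∈ S
      rwa [(chartAt E2 c).left_inv (hS hp)]
    · change t • direction u ψ ((chartAt E2 c).symm (chartAt E2 c p)) = _
      rw [(chartAt E2 c).left_inv (hS hp)]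

/-- The weight `h⁻²` cancels the conformal factor, leaving the round area of the projected piece,
which is three times the volume of its cone. Measurability is needed to add the pieces up. -/
theorem measurableSet_and_lintegral_chartArea (hψ : IsSpacelikeImmersion ψ) (hu : mink u u = -1)
    (hu0 : u 0 < 0) (hcone : ∀ p, ψ p ∈ futureCone) (c : S2) {S : Set S2} (hS : MeasurableSet S)
    (hSc : S ⊆ (chartAt E2 c).source) :
    MeasurableSet (coneOver (direction u ψ) S) ∧
    ∫⁻ p in S, ENNReal.ofReal ((mink (ψ p) u ^ 2)⁻¹) ∂(chartArea ψ (chartAt E2 c))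
      = 3 * volume (coneOver (direction u ψ) S) := by
  set e := chartAt E2 c with he
  set f := direction u (ψ ∘ e.symm) with hf
  have hB := measurableSet_target_inter_preimage e hS
  set B := e.target ∩ e.symm ⁻¹' S with hBdef
  have hderiv : ∀ y ∈ B, HasStrictFDerivAt f (fderiv ℝ f y) y :=
    fun y hy => hasStrictFDerivAt_direction hψ hu hu0 hcone c hy.1
  have hunit : ∀ y ∈ B, ‖f y‖ = 1 := fun y _ => norm_direction hu hu0 (fun _ => hcone _) y
  have hinj : InjOn f B := fun y hy z hz hyz =>
    e.symm.injOn hy.1 hz.1 (direction_injective hψ hu hu0 hcone hyz)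
  rw [← coneMap_image_cylinder c hSc]
  constructor
  · exact (measurableSet_cylinder hB).image_of_continuousOn_injOn
      (fun x hx => (hasStrictFDerivAt_coneMap (hderiv _ hx.2)).continuousAt.continuousWithinAt)
      (injOn_coneMap hunit hinj)
  · have hmeas : Measurable fun p => ENNReal.ofReal ((mink (ψ p) u ^ 2)⁻¹) :=
      ((((minkLeft u).continuous.comp hψ.1.continuous).measurable.pow_const 2).inv).ennreal_ofReal
    rw [volume_image_coneMap hB hderiv (measurable_parallelogramArea_fderiv f) hunit
      (fun y hy => inner_direction_fderiv hu hu0 (contDiffAt_comp_chart_symm hψ c hy.1)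
        fun _ => hcone _) hinj, setLIntegral_chartArea ψ e hS hmeas, ← mul_assoc]
    have h3 : (3 : ℝ≥0∞) * ENNReal.ofReal (1 / 3) = 1 := by
      rw [← ENNReal.ofReal_ofNat, ← ENNReal.ofReal_mul (by norm_num)]
      norm_num
    rw [h3, one_mul]
    refine setLIntegral_congr_fun hB fun y hy => ?_
    have hpos := mink_pos_of_mem_futureCone hu hu0 (hcone (e.symm y))
    rw [areaDensity_eq hψ hu hu0 hcone c hy.1, ← ENNReal.ofReal_mul
      (mul_nonneg (sq_nonneg _) (parallelogramArea_nonneg _)), ← he, mul_right_comm,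
      mul_inv_cancel₀ (pow_pos hpos 2).ne', one_mul]

/-- Since `direction` is injective, disjoint pieces of the surface have disjoint cones, so the
chartwise identities add up. -/
theorem setLIntegral_areaMeasure (hψ : IsSpacelikeImmersion ψ) (hu : mink u u = -1) (hu0 : u 0 < 0)
    (hcone : ∀ p, ψ p ∈ futureCone) {S : Set S2} (hS : MeasurableSet S) :
    ∫⁻ p in S, ENNReal.ofReal ((mink (ψ p) u ^ 2)⁻¹) ∂(areaMeasure ψ)
      = 3 * volume (coneOver (direction u ψ) S) := by
  set D := disjointed (fun j => (chartAt E2 (chartCenter S2 j)).source) with hD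
  have hDm : ∀ k, MeasurableSet (D k) := fun k =>
    MeasurableSet.disjointed (fun j => (chartAt E2 (chartCenter S2 j)).open_source.measurableSet) k
  have hDsub : ∀ k, D k ⊆ (chartAt E2 (chartCenter S2 k)).source := fun k => disjointed_subset _ k
  have hDU : ⋃ k, D k = univ := by
    rw [hD, iUnion_disjointed]
    exact (exists_chart_cover S2).choose_spec
  have hSU : S = ⋃ k, S ∩ D k := by rw [← inter_iUnion, hDU, inter_univ]
  have hpiece : ∀ k, _ := fun k => measurableSet_and_lintegral_chartArea hψ hu hu0 hcone
    (chartCenter S2 k) (hS.inter (hDm k)) (inter_subset_right.trans (hDsub k))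
  have hvol : volume (coneOver (direction u ψ) S)
      = ∑' k, volume (coneOver (direction u ψ) (S ∩ D k)) := by
    conv_lhs => rw [hSU, coneOver_iUnion]
    refine measure_iUnion (fun i j hij => ?_) fun k => (hpiece k).1
    exact disjoint_coneOver (norm_direction hu hu0 hcone) (direction_injective hψ hu hu0 hcone)
      ((disjoint_disjointed _ hij).mono inter_subset_right inter_subset_right)
  rw [hvol, ← ENNReal.tsum_mul_left, areaMeasure, Measure.restrict_sum _ hS, lintegral_sum_measure]
  refine tsum_congr fun k => ?_
  rw [Measure.restrict_restrict hS]
  exact (hpiece k).2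

/-- The cone over the whole sphere is the punctured unit ball, of volume `4π / 3`. -/
theorem lintegral_areaMeasure (hψ : IsSpacelikeImmersion ψ) (hu : mink u u = -1) (hu0 : u 0 < 0)
    (hcone : ∀ p, ψ p ∈ futureCone) :
    ∫⁻ p, ENNReal.ofReal ((mink (ψ p) u ^ 2)⁻¹) ∂(areaMeasure ψ) = ENNReal.ofReal (4 * Real.pi) := by
  rw [← setLIntegral_univ, setLIntegral_areaMeasure hψ hu hu0 hcone MeasurableSet.univ,
    coneOver_univ (norm_direction hu hu0 hcone) (fun x => exists_direction_eq hψ hu hu0 hcone),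
    measure_sdiff_null (measure_singleton _), EuclideanSpace.volume_ball_fin_three,
    ← ENNReal.ofReal_ofNat, ENNReal.ofReal_one, one_pow, one_mul,
    ← ENNReal.ofReal_mul (by norm_num)]
  congr 1
  ring

/-- The cone over an open piece contains a nonempty open set, so it has positive volume. Full
support turns equality almost everywhere into equality everywhere in the case of equality. -/
theorem areaMeasure_pos_of_isOpen (hψ : IsSpacelikeImmersion ψ) (hu : mink u u = -1) (hu0 : u 0 < 0)
    (hcone : ∀ p, ψ p ∈ futureCone) {U : Set S2} (hU : IsOpen U) (hne : U.Nonempty) :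
    areaMeasure ψ U ≠ 0 := by
  intro h0
  have h := setLIntegral_areaMeasure hψ hu hu0 hcone hU.measurableSet
  rw [Measure.restrict_eq_zero.2 h0, lintegral_zero_measure, eq_comm, mul_eq_zero] at h
  have hvol : volume (coneOver (direction u ψ) U) = 0 := h.resolve_left (by norm_num)
  have hopen := (isLocalHomeomorph_directionSphere hψ hu hu0 hcone).isOpenMap U hU
  obtain ⟨O, hO, hOU⟩ := isOpen_induced_iff.1 hopen
  have hcont : ContinuousOn (fun x : E3 => ‖x‖⁻¹ • x) ({0}ᶜ ∩ Metric.ball 0 1) := fun x hx =>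
    ((continuous_norm.continuousAt.inv₀ (norm_ne_zero_iff.2 hx.1)).smul
      continuousAt_id).continuousWithinAt
  have hW := hcont.isOpen_inter_preimage (isOpen_compl_singleton.inter Metric.isOpen_ball) hO
  refine (hW.measure_pos volume ?_).ne' (measure_mono_null ?_ hvol)
  · obtain ⟨p, hp⟩ := hne
    have hd := norm_direction hu hu0 hcone p
    have hp0 : direction u ψ p ≠ 0 := fun h => by simp [h] at hd
    have hn : ‖(1 / 2 : ℝ) • direction u ψ p‖ = 1 / 2 := by rw [norm_smul, hd]; norm_num
    refine ⟨(1 / 2 : ℝ) • direction u ψ p, ⟨smul_ne_zero (by norm_num) hp0, ?_⟩, ?_⟩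
    · rw [mem_ball_zero_iff, hn]
      norm_num
    · rw [mem_preimage, hn, smul_smul]
      norm_num
      have : directionSphere hu hu0 hcone p ∈ Subtype.val ⁻¹' O := hOU ▸ mem_image_of_mem _ hp
      exact this
  · rintro x ⟨⟨hx0, hx1⟩, hxO⟩
    have hpos : 0 < ‖x‖ := norm_pos_iff.2 hx0
    have hz : ‖‖x‖⁻¹ • x‖ = 1 := by rw [norm_smul, norm_inv, norm_norm, inv_mul_cancel₀ hpos.ne']
    have hmem : (⟨‖x‖⁻¹ • x, by simpa using hz⟩ : S2) ∈ directionSphere hu hu0 hcone '' U := by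
      rw [← hOU]
      exact hxO
    obtain ⟨p, hp, hpx⟩ := hmem
    refine ⟨p, hp, ‖x‖, ⟨hpos, mem_ball_zero_iff.1 hx1⟩, ?_⟩
    have hpx' : direction u ψ p = ‖x‖⁻¹ • x := congrArg Subtype.val hpx
    rw [hpx', smul_inv_smul₀ hpos.ne']

end Area

/-! ### Cauchy-Schwarz with its case of equality -/

section CauchySchwarz

variable {X : Type*} [TopologicalSpace X] [CompactSpace X] [MeasurableSpace X]
  {μ : Measure X} {h : X → ℝ} {c : ℝ}

/-- By compactness `h` is bounded above, so `h⁻²` is bounded below by a positive constant while its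
integral is finite. -/
theorem isFiniteMeasure_of_lintegral_inv_sq (hh : Continuous h) (hpos : ∀ x, 0 < h x)
    (hint : ∫⁻ x, ENNReal.ofReal ((h x ^ 2)⁻¹) ∂μ = ENNReal.ofReal c) : IsFiniteMeasure μ := by
  rcases isEmpty_or_nonempty X with hX | hX
  · exact ⟨by simp [univ_eq_empty_iff.2 hX]⟩
  obtain ⟨x₀, -, hx₀⟩ := isCompact_univ.exists_isMaxOn univ_nonempty hh.continuousOn
  have hle : ENNReal.ofReal ((h x₀ ^ 2)⁻¹) * μ univ ≤ ENNReal.ofReal c := by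
    rw [← hint, ← lintegral_const]
    refine lintegral_mono fun x => ENNReal.ofReal_le_ofReal ?_
    have := hx₀ (mem_univ x)
    have := hpos x
    gcongr
    exact hx₀ (mem_univ x)
  refine ⟨lt_of_le_of_ne le_top fun htop => ?_⟩
  rw [htop, ENNReal.mul_top] at hle
  · exact ENNReal.ofReal_ne_top (top_le_iff.1 hle)
  · simpa using (hpos x₀).ne'

theorem eLpNorm_two_eq_sqrt [BorelSpace X] [IsFiniteMeasure μ] (hh : Continuous h) :
    eLpNorm h 2 μ = ENNReal.ofReal (Real.sqrt (∫ x, h x ^ 2 ∂μ)) := by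
  have hmem : MemLp h 2 μ := hh.memLp_of_hasCompactSupport (HasCompactSupport.of_compactSpace _)
  rw [hmem.eLpNorm_eq_integral_rpow_norm (by norm_num) (by norm_num), Real.sqrt_eq_rpow]
  norm_num

theorem integral_sub_div_sq [BorelSpace X] [IsFiniteMeasure μ] (hh : Continuous h)
    (hpos : ∀ x, 0 < h x) (a : ℝ) :
    ∫ x, (h x - a / h x) ^ 2 ∂μ
      = ∫ x, h x ^ 2 ∂μ - 2 * a * μ.real univ + a ^ 2 * ∫ x, (h x ^ 2)⁻¹ ∂μ := by
  have h1 : Integrable (fun x => h x ^ 2) μ :=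
    (hh.pow 2).integrable_of_hasCompactSupport (HasCompactSupport.of_compactSpace _)
  have h2 : Integrable (fun x => (h x ^ 2)⁻¹) μ :=
    ((hh.pow 2).inv₀ fun x => (pow_pos (hpos x) 2).ne').integrable_of_hasCompactSupport
      (HasCompactSupport.of_compactSpace _)
  have hfun : (fun x => (h x - a / h x) ^ 2)
      = fun x => h x ^ 2 - 2 * a + a ^ 2 * (h x ^ 2)⁻¹ := by
    funext x
    have := (hpos x).ne'
    field_simp
    ring
  have h3 : Integrable (fun x => h x ^ 2 - 2 * a) μ := h1.sub (integrable_const _)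
  rw [hfun, integral_add h3 (h2.const_mul _), integral_sub h1 (integrable_const _),
    integral_const, integral_const_mul, smul_eq_mul]
  ring

/-- The Cauchy-Schwarz inequality for `1 = h · h⁻¹`, with its case of equality. -/
theorem measure_univ_le_mul_eLpNorm [BorelSpace X] [IsFiniteMeasure μ] [μ.IsOpenPosMeasure]
    [Nonempty X] (hc : 0 < c) (hh : Continuous h) (hpos : ∀ x, 0 < h x)
    (hint : ∫⁻ x, ENNReal.ofReal ((h x ^ 2)⁻¹) ∂μ = ENNReal.ofReal c) :
    μ univ ≤ ENNReal.ofReal (Real.sqrt c) * eLpNorm h 2 μ ∧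
    (μ univ = ENNReal.ofReal (Real.sqrt c) * eLpNorm h 2 μ ↔ ∃ r, 0 < r ∧ ∀ x, h x = r) := by
  have hinv : ∫ x, (h x ^ 2)⁻¹ ∂μ = c := by
    rw [integral_eq_lintegral_of_nonneg_ae
      (Filter.Eventually.of_forall fun x => (inv_pos.2 (pow_pos (hpos x) 2)).le)
      ((hh.pow 2).inv₀ fun x => (pow_pos (hpos x) 2).ne').aestronglyMeasurable, hint,
      ENNReal.toReal_ofReal hc.le]
  set A := μ.real univ with hA
  set K := ∫ x, h x ^ 2 ∂μ with hK
  have hA0 : 0 ≤ A := measureReal_nonneg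
  have hK0 : 0 ≤ K := integral_nonneg fun x => sq_nonneg _
  have hμ : μ univ = ENNReal.ofReal A := (ofReal_measureReal (measure_ne_top _ _)).symm
  have hrhs : ENNReal.ofReal (Real.sqrt c) * eLpNorm h 2 μ = ENNReal.ofReal (Real.sqrt (c * K)) := by
    rw [eLpNorm_two_eq_sqrt hh, ← ENNReal.ofReal_mul (Real.sqrt_nonneg _), Real.sqrt_mul hc.le]
  -- `A / c` is the coefficient of the `L²` projection of `h` onto `h⁻¹`, because `∫ h · h⁻¹ = A`
  -- and `∫ h⁻² = c`. The integral is the Cauchy-Schwarz defect divided by `c`.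
  have hkey : ∫ x, (h x - A / c / h x) ^ 2 ∂μ = (c * K - A ^ 2) / c := by
    rw [integral_sub_div_sq hh hpos, hinv, ← hA, ← hK]
    field_simp
    ring
  rw [hrhs, hμ]
  have hle : A ^ 2 ≤ c * K := by
    have h0 : 0 ≤ (c * K - A ^ 2) / c := hkey ▸ integral_nonneg fun x => sq_nonneg _
    rw [le_div_iff₀ hc] at h0
    linarith
  refine ⟨ENNReal.ofReal_le_ofReal (Real.le_sqrt_of_sq_le hle), ?_⟩
  rw [ENNReal.ofReal_eq_ofReal_iff hA0 (Real.sqrt_nonneg _), eq_comm,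
    Real.sqrt_eq_iff_mul_self_eq (mul_nonneg hc.le hK0) hA0]
  constructor
  · intro heq
    have hcont : Continuous fun x => (h x - A / c / h x) ^ 2 :=
      (hh.sub (continuous_const.div hh fun x => (hpos x).ne')).pow 2
    have hzero : ∫ x, (h x - A / c / h x) ^ 2 ∂μ = 0 := by
      rw [hkey, heq]
      ring
    have hae := (integral_eq_zero_iff_of_nonneg (fun x => sq_nonneg _)
      (hcont.integrable_of_hasCompactSupport (HasCompactSupport.of_compactSpace _))).1 hzero
    -- A continuous function that vanishes almost everywhere vanishes everywhere, as nonempty open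
    -- sets have positive measure.
    have hall := congrFun (hcont.ae_eq_iff_eq μ continuous_const |>.1 hae)
    have hsq : ∀ x, h x ^ 2 = A / c := fun x => by
      have h1 : h x - A / c / h x = 0 := pow_eq_zero_iff (two_ne_zero) |>.1 (hall x)
      have h2 := (hpos x).ne'
      rw [sub_eq_zero, eq_div_iff h2] at h1
      rw [sq, h1]
    refine ⟨Real.sqrt (A / c), ?_, fun x => ?_⟩
    · obtain ⟨x⟩ := ‹Nonempty X›
      rw [← hsq x]
      exact Real.sqrt_pos.2 (pow_pos (hpos x) 2)
    · rw [← hsq x, Real.sqrt_sq (hpos x).le]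
  · rintro ⟨r, hr, hconst⟩
    have h1 : A * (r ^ 2)⁻¹ = c := by
      rw [← hinv]
      simp [hconst, hA]
    have h2 : K = A * r ^ 2 := by simp [hK, hconst, hA]
    rw [h2, ← h1]
    field_simp

end CauchySchwarz

/-! ### Umbilicity of the round spheres -/

section Umbilical

/-- The Lorentzian metric as a continuous bilinear form, with its arguments exchanged. -/
noncomputable def minkBilin : L4 →L[ℝ] L4 →L[ℝ] ℝ :=
  LinearMap.toContinuousLinearMap
    { toFun := minkLeft
      map_add' := fun x y => by ext z; simp [mink_add_right]
      map_smul' := fun c x => by ext z; simp [mink_smul_right] }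

theorem mink_deriv_eq_zero_of_eventually_const {a b : E2 → L4} {a' b' : E2 →L[ℝ] L4} {y : E2} {k : ℝ}
    (ha : HasFDerivAt a a' y) (hb : HasFDerivAt b b' y)
    (hab : ∀ᶠ z in nhds y, mink (a z) (b z) = k) (v : E2) :
    mink (a' v) (b y) + mink (a y) (b' v) = 0 := by
  have h1 := (minkBilin.hasFDerivAt.comp y hb).clm_apply ha
  have h2 : HasFDerivAt (fun z => mink (a z) (b z)) (0 : E2 →L[ℝ] ℝ) y :=
    (hasFDerivAt_const k y).congr_of_eventuallyEq hab
  exact congrArg (fun L : E2 →L[ℝ] ℝ => L v) (h1.unique h2)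

/-- Dimension count: the orthogonal complement of `u` and `x` is a plane and contains the
two-dimensional range of `d`. -/
theorem mem_range_of_orthogonal {d : E2 →L[ℝ] L4} {u x : L4} {r : ℝ} (hr : r ≠ 0)
    (hu : mink u u = -1) (hx : mink x x = 0) (hxu : mink x u = r)
    (hd : Function.Injective d) (hdu : ∀ v, mink (d v) u = 0) (hdx : ∀ v, mink (d v) x = 0)
    {n : L4} (hnu : mink n u = 0) (hnx : mink n x = 0) : ∃ z, d z = n := by
  set T : L4 →ₗ[ℝ] ℝ × ℝ := (minkLeft u : L4 →ₗ[ℝ] ℝ).prod (minkLeft x : L4 →ₗ[ℝ] ℝ) with hT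
  have hTapply : ∀ n, T n = (mink n u, mink n x) := fun n => rfl
  have hsurj : Function.Surjective T := by
    rintro ⟨a, b⟩
    -- For `n = α u + β x` the equations are `-α + β r = a` and `α r = b`.
    refine ⟨(b / r) • u + ((a + b / r) / r) • x, ?_⟩
    rw [hTapply, mink_add_left, mink_add_left, mink_smul_left, mink_smul_left, mink_smul_left,
      mink_smul_left, hu, hx, hxu, mink_comm u x, hxu]
    ext
    · simp only
      field_simp
      ring
    · simp only
      field_simp
      ring
  have hrank := T.finrank_range_add_finrank_ker
  rw [LinearMap.range_eq_top.2 hsurj, finrank_top, Module.finrank_prod, Module.finrank_self,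
    Module.finrank_fintype_fun_eq_card, Fintype.card_fin] at hrank
  have hrange : Module.finrank ℝ (LinearMap.range (d : E2 →ₗ[ℝ] L4)) = 2 := by
    rw [LinearMap.finrank_range_of_inj hd, finrank_euclideanSpace_fin]
  have hle : LinearMap.range (d : E2 →ₗ[ℝ] L4) ≤ LinearMap.ker T := by
    rintro _ ⟨v, rfl⟩
    rw [LinearMap.mem_ker, hTapply]
    exact Prod.ext (hdu v) (hdx v)
  have heq := Submodule.eq_of_le_of_finrank_eq hle (by omega)
  have hn : n ∈ LinearMap.ker T := by
    rw [LinearMap.mem_ker, hTapply, hnu, hnx]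
    rfl
  rw [← heq] at hn
  exact hn

/-- A surface in the intersection of the lightcone with the spacelike hyperplane `⟨·, u⟩ = r` has
second fundamental form `⟨X, Y⟩ H` with `H = -r⁻¹ u - r⁻² f`. -/
theorem exists_umbilical_vector {f : E2 → L4} {y : E2} {u : L4} {r : ℝ} (hr : r ≠ 0)
    (hu : mink u u = -1) (hf : ContDiffAt ℝ ∞ f y)
    (hnull : ∀ z, mink (f z) (f z) = 0) (hfu : ∀ z, mink (f z) u = r)
    (hpos : ∀ v, v ≠ 0 → 0 < mink (fderiv ℝ f y v) (fderiv ℝ f y v)) :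
    ∃ H : L4, (∀ v, mink (fderiv ℝ f y v) H = 0) ∧
      ∀ v w, ∃ z, fderiv ℝ (fderiv ℝ f) y v w
        = fderiv ℝ f y z + mink (fderiv ℝ f y v) (fderiv ℝ f y w) • H := by
  have hd : ∀ᶠ z in nhds y, HasFDerivAt f (fderiv ℝ f z) z := by
    filter_upwards [(hf.of_le (m := 1) (by simp)).eventually (by simp)] with z hz
    exact (hz.differentiableAt (by simp)).hasFDerivAt
  have hdd : HasFDerivAt (fderiv ℝ f) (fderiv ℝ (fderiv ℝ f) y) y :=
    ((hf.fderiv_right (m := 1) (WithTop.coe_le_coe.2 le_top)).differentiableAt (by simp)).hasFDerivAt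
  have hddw : ∀ w, HasFDerivAt (fun z => fderiv ℝ f z w) ((fderiv ℝ (fderiv ℝ f) y).flip w) y := by
    intro w
    have := hdd.clm_apply (hasFDerivAt_const w y)
    simpa using this
  have h1 : ∀ᶠ z in nhds y, ∀ w, mink (fderiv ℝ f z w) u = 0 := by
    filter_upwards [hd] with z hz w
    have := mink_deriv_eq_zero_of_eventually_const hz (hasFDerivAt_const u z)
      (Filter.Eventually.of_forall hfu) w
    simpa [mink] using this
  have h2 : ∀ᶠ z in nhds y, ∀ w, mink (fderiv ℝ f z w) (f z) = 0 := by
    filter_upwards [hd] with z hz w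
    have := mink_deriv_eq_zero_of_eventually_const hz hz (Filter.Eventually.of_forall hnull) w
    rw [mink_comm (f z)] at this
    linarith
  -- Second differentiation of the two constraints; the first-order relations hold near `y`, so they
  -- can be differentiated at `y`.
  have h3 : ∀ v w, mink (fderiv ℝ (fderiv ℝ f) y v w) u = 0 := by
    intro v w
    have := mink_deriv_eq_zero_of_eventually_const (hddw w) (hasFDerivAt_const u y)
      (h1.mono fun z hz => hz w) v
    simpa [mink] using this
  have h4 : ∀ v w, mink (fderiv ℝ (fderiv ℝ f) y v w) (f y)
      = -mink (fderiv ℝ f y v) (fderiv ℝ f y w) := by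
    intro v w
    have := mink_deriv_eq_zero_of_eventually_const (hddw w) hd.self_of_nhds
      (h2.mono fun z hz => hz w) v
    rw [ContinuousLinearMap.flip_apply, mink_comm (fderiv ℝ f y w)] at this
    linarith
  have hinj : Function.Injective (fderiv ℝ f y) := by
    rw [injective_iff_map_eq_zero]
    intro v hv
    by_contra hne
    have := hpos v hne
    rw [hv] at this
    simp [mink] at this
  have h1y := h1.self_of_nhds
  have h2y := h2.self_of_nhds
  -- The coefficients solve `⟨H, u⟩ = 0` and `⟨H, f y⟩ = -1`. By `h3` and `h4`, the second
  -- derivative minus `m • H` is then orthogonal to `u` and `f y`, hence tangent.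
  refine ⟨(-r⁻¹) • u + (-(r ^ 2)⁻¹) • f y, fun v => ?_, fun v w => ?_⟩
  · rw [mink_add_right, mink_smul_right, mink_smul_right, h1y, h2y]
    ring
  · set m := mink (fderiv ℝ f y v) (fderiv ℝ f y w) with hm
    obtain ⟨z, hz⟩ := mem_range_of_orthogonal (n := fderiv ℝ (fderiv ℝ f) y v w
      - m • ((-r⁻¹) • u + (-(r ^ 2)⁻¹) • f y)) hr hu (hnull y) (hfu y) hinj h1y h2y
      (by
        rw [mink_sub_left, mink_smul_left, mink_add_left, mink_smul_left, mink_smul_left, h3, hu, hfu]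
        field_simp
        ring)
      (by
        rw [mink_sub_left, mink_smul_left, mink_add_left, mink_smul_left, mink_smul_left, h4, hnull,
          mink_comm u, hfu]
        field_simp
        ring)
    exact ⟨z, by rw [hz]; abel⟩

end Umbilical

end Lightcone

/-! ### Assembly of the theorem -/

open Lightcone in
theorem proposition5p7 (ψ : Lightcone.S2 → Lightcone.L4)
    (hψ : Lightcone.IsSpacelikeImmersion ψ) (hcone : ∀ p, ψ p ∈ Lightcone.futureCone)
    (u : Lightcone.L4) (hu : Lightcone.mink u u = -1) (hu0 : u 0 < 0) :
    MemLp (fun p => Lightcone.mink (ψ p) u) 2 (Lightcone.areaMeasure ψ) ∧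
    Lightcone.areaMeasure ψ univ ≤ ENNReal.ofReal (2 * Real.sqrt Real.pi) *
      eLpNorm (fun p => Lightcone.mink (ψ p) u) 2 (Lightcone.areaMeasure ψ) ∧
    (Lightcone.areaMeasure ψ univ = ENNReal.ofReal (2 * Real.sqrt Real.pi) *
        eLpNorm (fun p => Lightcone.mink (ψ p) u) 2 (Lightcone.areaMeasure ψ) ↔
      ∃ r : ℝ, 0 < r ∧ (∀ p, Lightcone.mink (ψ p) u = r) ∧
        range ψ = Lightcone.roundSphere u r) ∧
    (∀ r : ℝ, 0 < r → range ψ = Lightcone.roundSphere u r → Lightcone.IsTotallyUmbilical ψ) := by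
  have hh : Continuous fun p => mink (ψ p) u := (minkLeft u).continuous.comp hψ.1.continuous
  have hpos : ∀ p, 0 < mink (ψ p) u := fun p => mink_pos_of_mem_futureCone hu hu0 (hcone p)
  have hint := lintegral_areaMeasure hψ hu hu0 hcone
  have hfin : IsFiniteMeasure (areaMeasure ψ) := isFiniteMeasure_of_lintegral_inv_sq hh hpos hint
  have hopen : (areaMeasure ψ).IsOpenPosMeasure :=
    ⟨fun U hU hne => areaMeasure_pos_of_isOpen hψ hu hu0 hcone hU hne⟩
  have hsqrt : 2 * Real.sqrt Real.pi = Real.sqrt (4 * Real.pi) := by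
    rw [Real.sqrt_mul (by norm_num), show (4 : ℝ) = 2 ^ 2 by norm_num, Real.sqrt_sq (by norm_num)]
  obtain ⟨hle, heq⟩ := measure_univ_le_mul_eLpNorm (by positivity) hh hpos hint
  rw [hsqrt]
  refine ⟨hh.memLp_of_hasCompactSupport (HasCompactSupport.of_compactSpace _), hle, heq.trans ?_, ?_⟩
  · refine exists_congr fun r => and_congr_right fun hr =>
      ⟨fun h => ⟨h, Subset.antisymm ?_ fun x hx => ?_⟩, fun h => h.1⟩
    · rintro _ ⟨p, rfl⟩
      exact ⟨(hcone p).1, by rw [mink_comm, h]⟩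
    · obtain ⟨hx0, hxr⟩ := hx
      rw [mink_comm] at hxr
      have hnorm : ‖r⁻¹ • boost u x‖ = 1 := by
        rw [norm_smul, norm_boost_of_null hu hu0 hx0, hxr, norm_inv, Real.norm_eq_abs,
          inv_mul_cancel₀ (abs_pos.2 hr.ne').ne']
      -- Some `ψ p` lies on the same light ray as `x`; both have height `r`, so they coincide.
      obtain ⟨p, hp⟩ := exists_direction_eq hψ hu hu0 hcone hnorm
      refine ⟨p, eq_of_boost_eq hu hu0 (by rw [h, hxr]) ?_⟩
      rw [← smul_direction hu hu0 hcone p, hp, h, smul_inv_smul₀ hr.ne']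
  · intro r hr hrange p
    have hmem : ∀ q, ψ q ∈ roundSphere u r := fun q => hrange ▸ mem_range_self q
    have hp : chartAt E2 p p ∈ (chartAt E2 p).target :=
      (chartAt E2 p).map_source (mem_chart_source E2 p)
    exact exists_umbilical_vector hr.ne' hu (contDiffAt_comp_chart_symm hψ p hp)
      (fun z => (hmem _).1) (fun z => by rw [mink_comm]; exact (hmem _).2)
      (fun v hv => mink_fderiv_comp_chart_symm_pos hψ p hp hv)
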